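/- Let $(R,\mathfrak m)$ be a Cohen–Macaulay (in particular Noetherian) local ring, and suppose that $R$ possesses a canonical module $\mathrm K_R$, that is, a maximal Cohen–Macaulay $R$-module of Cohen–Macaulay type one and of finite injective dimension. Let $M$ be a maximal Cohen–Macaulay $R$-module, i.e. a finitely generated $R$-module with $\operatorname{depth}_R M=\dim R$ (the zero module has depth $\infty$). Let $R\ltimes M$ be the idealization of $M$, i.e. the ring $R\oplus M$ with multiplication $(a,x)(b,y)=(ab,\,ay+bx)$; it is again a local ring. For a local ring $(S,\mathfrak n)$ and an $S$-module $N$ put $\mathrm r_S(N)=\ell_S\big(\operatorname{Ext}_S^{\dim S}(S/\mathfrak n,N)\big)$ and $\mathrm r(S)=\mathrm r_S(S)$, where $\ell_S$ denotes length. Let $$t:\operatorname{Hom}_R(M,\mathrm K_R)\otimes_R M\to \mathrm K_R,\qquad t(f\otimes m)=f(m),$$ be the evaluation map, and let $\mu_R(C)$ denote the number of elements in a minimal system of generators of a finitely generated $R$-module $C$. Then $$\mathrm r(R\ltimes M)=\mathrm r_R(M)+\mu_R(\operatorname{Coker} t).$$ -/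

import Mathlib

open CategoryTheory
open scoped TensorProduct

universe u

namespace Idealization

noncomputable section

/-- The depth of a finitely generated module `M` over a Noetherian local ring `(R, 𝔪)`: the supremum
of the lengths of the `M`-regular sequences contained in `𝔪`. The condition `M ≠ (rs) M` is not
required of the sequences: for nonzero finitely generated `M` it is automatic by Nakayama's lemma,
and the zero module gets depth `∞`, as is customary. -/
def depth (R : Type*) [CommRing R] [IsLocalRing R]
    (M : Type*) [AddCommGroup M] [Module R M] : ℕ∞ :=
  ⨆ (rs : List R) (_ : (∀ r ∈ rs, r ∈ IsLocalRing.maximalIdeal R) ∧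
    RingTheory.Sequence.IsWeaklyRegular M rs), (rs.length : ℕ∞)

/-- The Krull dimension as a natural number (it is finite for every Noetherian local ring). -/
def dim (R : Type*) [CommRing R] : ℕ :=
  ((ringKrullDim R).unbotD 0).toNat

/-- A Cohen-Macaulay local ring: a Noetherian local ring with `depth R = dim R`. -/
structure IsCohenMacaulay (R : Type*) [CommRing R] [IsLocalRing R] : Prop where
  noetherian : IsNoetherianRing R
  depth_eq : ((depth R R : ℕ∞) : WithBot ℕ∞) = ringKrullDim R

/-- A maximal Cohen-Macaulay module: a finitely generated module with `depth M = dim R`. -/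
structure IsMCM (R : Type*) [CommRing R] [IsLocalRing R]
    (M : Type*) [AddCommGroup M] [Module R M] : Prop where
  finite : Module.Finite R M
  depth_eq : ((depth R M : ℕ∞) : WithBot ℕ∞) = ringKrullDim R

/-- The Cohen-Macaulay type `r_R(M) = ℓ_R(Ext_R^d(R/𝔪, M))`, `d = dim R`. The type of the ring `R`
is `r(R) = r_R(R)`. -/
def cmType (R : Type u) [CommRing R] [IsLocalRing R]
    (M : Type u) [AddCommGroup M] [Module R M] : ℕ∞ :=
  Module.length R
    (Abelian.Ext (ModuleCat.of R (R ⧸ IsLocalRing.maximalIdeal R)) (ModuleCat.of R M) (dim R))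

/-- A canonical module of a Cohen-Macaulay local ring: a maximal Cohen-Macaulay module of
Cohen-Macaulay type one and of finite injective dimension. -/
structure IsCanonicalModule (R : Type u) [CommRing R] [IsLocalRing R]
    (K : Type u) [AddCommGroup K] [Module R K] : Prop where
  isMCM : IsMCM R K
  cmType_eq_one : cmType R K = 1
  finite_injectiveDimension : ∃ n : ℕ, HasInjectiveDimensionLE (ModuleCat.of R K) n

/-- The number `μ_R(M)` of elements in a minimal system of generators of a finitely generated
module, that is, the least cardinality of a generating set. -/
def mu (R : Type*) [CommRing R] (M : Type*) [AddCommGroup M] [Module R M] : ℕ :=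
  (⊤ : Submodule R M).spanFinrank

/-- The evaluation map `t : Hom_R(M, N) ⊗_R M → N`, `f ⊗ m ↦ f m`. -/
def evalMap (R : Type*) [CommRing R] (M N : Type*) [AddCommGroup M] [Module R M]
    [AddCommGroup N] [Module R N] : (M →ₗ[R] N) ⊗[R] M →ₗ[R] N :=
  TensorProduct.lift LinearMap.id

@[simp]
theorem evalMap_tmul (R : Type*) [CommRing R] (M N : Type*) [AddCommGroup M] [Module R M]
    [AddCommGroup N] [Module R N] (f : M →ₗ[R] N) (m : M) :
    evalMap R M N (f ⊗ₜ[R] m) = f m := by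
  simp [evalMap]

/-- The idealization `R ⋉ M` of a module over a local ring is a local ring. -/
instance isLocalRing_trivSqZeroExt (R : Type*) [CommRing R] [IsLocalRing R]
    (M : Type*) [AddCommGroup M] [Module R M] [Module Rᵐᵒᵖ M] [IsCentralScalar R M] :
    IsLocalRing (TrivSqZeroExt R M) :=
  IsLocalRing.of_nonunits_add fun a b ha hb => by
    rw [mem_nonunits_iff, TrivSqZeroExt.isUnit_iff_isUnit_fst] at *
    rw [TrivSqZeroExt.fst_add]
    exact IsLocalRing.nonunits_add ha hb

end

end Idealization

/-! Put d = dim R. A sequence of length d in 𝔪 that is regular on R, M and K generates an ideal I of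
finite colength. Whenever such a sequence is regular on X, Ext^d(R/𝔪, X) ≅ Hom(R/𝔪, X/IX), so types
become lengths of socles (`length_ext_eq`). This applies over R, and over R ⋉ M to the same
sequence, because R ⋉ M is R × M as an R-module and has dimension d.

In (R ⋉ M)/I(R ⋉ M) = R/I ⋉ M/IM a pair (a, x) lies in the socle exactly when x ∈ Soc(M/IM) and a ∈
V, where V = Soc(R/I) ∩ Ann(M/IM). Hence r(R ⋉ M) = r(M) + ℓ(V)
(`length_torsionBySet_trivSqZeroExt`), and ℓ(V) = μ(Coker t) remains to be shown
(`mu_coker_evalMap`).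

The module E = K/IK has a socle of length one and behaves as an injective R/I-module on finite
length modules (`exists_comp_eq_of_ker_le`), since Ext^i(Q, K) = 0 for Q of finite length and i > d
(`subsingleton_ext_of_length_lt`). So K → Hom(V, E), x ↦ (a ↦ ax), is surjective. Its kernel is 𝔪K +
im t; here maps M → E have to be lifted to maps M → K, which Ext^i(M, K) = 0 for i > 0 allows
(`exists_comp_mkQ_eq`). Thus Coker t / 𝔪 Coker t ≅ Hom(V, E), which has length ℓ(V) because 𝔪V = 0.
-/

namespace Idealization

/-! ### Ext modulo a regular sequence -/

section Ext

open Abelian RingTheory.Sequence IsLocalRing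

variable {R : Type u} [CommRing R]

/-- The short complex `N → P → P ⧸ N` attached to a submodule `N` of `P`. -/
abbrev subShortComplex {P : Type u} [AddCommGroup P] [Module R P] (N : Submodule R P) :
    ShortComplex (ModuleCat.{u} R) :=
  ModuleCat.shortComplexOfCompEqZero N.subtype N.mkQ (by ext; simp)

lemma subShortComplex_shortExact {P : Type u} [AddCommGroup P] [Module R P]
    (N : Submodule R P) : (subShortComplex N).ShortExact :=
  ModuleCat.shortComplex_shortExact _ (LinearMap.exact_subtype_mkQ N) N.subtype_injective
    N.mkQ_surjective

lemma subsingleton_ext_of_submodule {P : Type u} [AddCommGroup P] [Module R P]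
    (N : Submodule R P) (K : ModuleCat.{u} R) (i : ℕ)
    (h₁ : Subsingleton (Ext (ModuleCat.of R N) K i))
    (h₃ : Subsingleton (Ext (ModuleCat.of R (P ⧸ N)) K i)) :
    Subsingleton (Ext (ModuleCat.of R P) K i) := by
  refine subsingleton_of_forall_eq 0 fun x => ?_
  obtain ⟨y, rfl⟩ := Ext.contravariant_sequence_exact₂ (subShortComplex_shortExact N) K
    (show Ext (ModuleCat.of R P) K i from x) (h₁.elim _ _)
  rw [h₃.elim y 0, Ext.comp_zero]

lemma subsingleton_ext_congr {A B : Type u} [AddCommGroup A] [Module R A] [AddCommGroup B]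
    [Module R B] (e : A ≃ₗ[R] B) (K : ModuleCat.{u} R) (i : ℕ)
    (h : Subsingleton (Ext (ModuleCat.of R A) K i)) :
    Subsingleton (Ext (ModuleCat.of R B) K i) := by
  refine subsingleton_of_forall_eq 0 fun x => ?_
  have hx : x = (Ext.mk₀ e.toModuleIso.inv).comp
      ((Ext.mk₀ e.toModuleIso.hom).comp x (zero_add i)) (zero_add i) := by
    rw [Ext.mk₀_comp_mk₀_assoc, Iso.inv_hom_id, Ext.mk₀_id_comp]
  rw [hx, h.elim (Ext.comp _ _ _) 0, Ext.comp_zero]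

lemma smul_ext_eq_mk₀_comp (r : R) {N K : ModuleCat.{u} R} {i : ℕ} (x : Ext N K i) :
    r • x = (Ext.mk₀ (r • 𝟙 N)).comp x (zero_add i) := by
  simp [Ext.mk₀_smul]

lemma smul_ext_eq_zero {r : R} (N K : ModuleCat.{u} R) (i : ℕ)
    (hr : r ∈ Module.annihilator R N) (x : Ext N K i) : r • x = 0 := by
  have h : r • 𝟙 N = 0 := by
    exact ModuleCat.hom_ext (LinearMap.ext fun y => Module.mem_annihilator.mp hr y)
  rw [smul_ext_eq_mk₀_comp, h, Ext.mk₀_zero, Ext.zero_comp]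

/-- Iterating the connecting homomorphisms of a weakly `K`-regular sequence `rs` of length `n` gives
a class in `Ext^n(K / rs K, K)` through which `Ext^n(-, K)` is represented on the modules killed by
`rs`. -/
lemma exists_ext_bijective (rs : List R) : ∀ (K : Type u) [AddCommGroup K] [Module R K],
    IsWeaklyRegular K rs →
    ∃ η : Ext (ModuleCat.of R (K ⧸ (Ideal.ofList rs • ⊤ : Submodule R K))) (ModuleCat.of R K)
        rs.length,
      ∀ N : ModuleCat.{u} R, (∀ r ∈ rs, r ∈ Module.annihilator R N) →
        (∀ i < rs.length, Subsingleton (Ext N (ModuleCat.of R K) i)) ∧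
        Function.Bijective fun f : N ⟶ ModuleCat.of R
            (K ⧸ (Ideal.ofList rs • ⊤ : Submodule R K)) =>
          (Ext.mk₀ f).comp η (zero_add rs.length) := by
  induction rs with
  | nil =>
    intro K _ _ _
    let e : (K ⧸ (Ideal.ofList ([] : List R) • ⊤ : Submodule R K)) ≃ₗ[R] K :=
      Submodule.quotEquivOfEqBot _ (by simp)
    refine ⟨Ext.mk₀ e.toModuleIso.hom, fun N _ => ⟨by simp, ?_⟩⟩
    have : (fun f : N ⟶ ModuleCat.of R (K ⧸ (Ideal.ofList ([] : List R) • ⊤ : Submodule R K)) =>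
        (Ext.mk₀ f).comp (Ext.mk₀ e.toModuleIso.hom) (zero_add 0)) =
        Ext.mk₀ ∘ fun f => f ≫ e.toModuleIso.hom := by
      ext1 f; simp
    simp only [List.length_nil]
    rw [this]
    exact (Ext.mk₀_bijective _ _).comp (Iso.homToEquiv e.toModuleIso).bijective
  | cons r rs ih =>
    intro K _ _ hK
    rw [isWeaklyRegular_cons_iff] at hK
    obtain ⟨η, hη⟩ := ih (QuotSMulTop r K) hK.2
    have hS := IsSMulRegular.smulShortComplex_shortExact (M := ModuleCat.of R K) hK.1
    let e := Submodule.quotOfListConsSMulTopEquivQuotSMulTopInner K r rs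
    let δ : Ext (ModuleCat.of R (QuotSMulTop r K)) (ModuleCat.of R K) 1 := hS.extClass
    refine ⟨(Ext.mk₀ e.toModuleIso.hom).comp (η.comp δ rfl) (zero_add (rs.length + 1)),
      fun N hN => ?_⟩
    obtain ⟨h1, h2⟩ := hη N fun s hs => hN s (List.mem_cons_of_mem _ hs)
    have hr := hN r List.mem_cons_self
    -- Since r kills N, multiplication by r on K induces zero on every Ext^i(N, K), and the long
    -- exact sequence breaks into short pieces.
    have hf : ∀ i (x : Ext N (ModuleCat.of R K) i), x.comp (Ext.mk₀
        ((ModuleCat.of R K).smulShortComplex r).f) (add_zero i) = 0 := by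
      intro i x
      rw [ModuleCat.smulShortComplex_f_eq_smul_id]
      exact (Ext.smul_eq_comp_mk₀ x r).symm.trans (smul_ext_eq_zero _ _ i hr x)
    have hlt : ∀ i < rs.length + 1, Subsingleton (Ext N (ModuleCat.of R K) i) := by
      intro i hi
      refine subsingleton_of_forall_eq 0 fun x => ?_
      rcases i with - | i
      · obtain ⟨f, rfl⟩ := (Ext.mk₀_bijective N
          ((ModuleCat.of R K).smulShortComplex r).X₁).surjective x
        have hf0 := (Ext.mk₀_comp_mk₀ f _).symm.trans (hf 0 (Ext.mk₀ f))
        have := hS.mono_f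
        rw [Ext.mk₀_eq_zero_iff] at hf0
        exact (Ext.mk₀_eq_zero_iff f).mpr (Limits.zero_of_comp_mono _ hf0)
      · obtain ⟨y, rfl⟩ := Ext.covariant_sequence_exact₁ N hS x (hf _ x) rfl
        rw [show y = 0 from (h1 i (by omega)).elim _ _, Ext.zero_comp]
        rfl
    refine ⟨hlt, ?_⟩
    -- Injectivity comes from the vanishing of Ext^n(N, K) for n = `rs.length`, surjectivity from
    -- `hf`.
    have hδ : Function.Bijective fun x : Ext N (ModuleCat.of R (QuotSMulTop r K)) rs.length =>
        x.comp δ rfl := by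
      constructor
      · intro x y hxy
        have : (x - y).comp δ rfl = 0 := by
          rw [sub_eq_add_neg, Ext.add_comp, Ext.neg_comp, ← sub_eq_add_neg, sub_eq_zero]
          exact hxy
        obtain ⟨z, hz⟩ := Ext.covariant_sequence_exact₃ N hS (x - y) rfl this
        rw [show z = 0 from (hlt rs.length (by omega)).elim _ _, Ext.zero_comp] at hz
        exact sub_eq_zero.mp hz.symm
      · intro x
        exact Ext.covariant_sequence_exact₁ N hS x (hf _ x) rfl
    have hcomp : (fun f : N ⟶ ModuleCat.of R
        (K ⧸ (Ideal.ofList (r :: rs) • ⊤ : Submodule R K)) => (Ext.mk₀ f).comp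
          ((Ext.mk₀ e.toModuleIso.hom).comp (η.comp δ rfl) (zero_add (rs.length + 1)))
          (zero_add (rs.length + 1))) =
        (fun x => x.comp δ rfl) ∘ (fun f => (Ext.mk₀ f).comp η (zero_add _)) ∘
          fun f => f ≫ e.toModuleIso.hom := by
      ext1 f
      simp only [Function.comp]
      rw [Ext.mk₀_comp_mk₀_assoc, Ext.comp_assoc _ _ _ _ _ (by omega)]
    exact hcomp ▸ hδ.comp (h2.comp (Iso.homToEquiv e.toModuleIso).bijective)

lemma annihilator_of_le_annihilator {rs : List R} {N : ModuleCat.{u} R}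
    (h : Ideal.ofList rs ≤ Module.annihilator R N) (r : R) (hr : r ∈ rs) :
    r ∈ Module.annihilator R N :=
  h (Ideal.subset_span hr)

/-- For N the residue field and n = dim R, this computes the Cohen–Macaulay type as the length of a
socle. -/
lemma length_ext_eq {rs : List R} {K : Type u} [AddCommGroup K] [Module R K]
    (hK : IsWeaklyRegular K rs) (N : Type u) [AddCommGroup N] [Module R N]
    (hN : Ideal.ofList rs ≤ Module.annihilator R N) :
    Module.length R (Ext (ModuleCat.of R N) (ModuleCat.of R K) rs.length) =
      Module.length R (N →ₗ[R] K ⧸ (Ideal.ofList rs • ⊤ : Submodule R K)) := by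
  obtain ⟨η, hη⟩ := exists_ext_bijective rs K hK
  have h := (hη (ModuleCat.of R N) (annihilator_of_le_annihilator hN)).2
  let L : (ModuleCat.of R N ⟶ ModuleCat.of R (K ⧸ (Ideal.ofList rs • ⊤ : Submodule R K)))
      →ₗ[R] Ext (ModuleCat.of R N) (ModuleCat.of R K) rs.length :=
    { toFun f := (Ext.mk₀ f).comp η (zero_add rs.length)
      map_add' f g := by rw [Ext.mk₀_add, Ext.add_comp]
      map_smul' c f := by rw [Ext.mk₀_smul, Ext.smul_comp]; rfl }
  exact ((LinearEquiv.ofBijective L h).symm.trans ModuleCat.homLinearEquiv).length_eq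

/-! ### Vanishing of Ext, and lifting and extending homomorphisms -/

lemma subsingleton_ext_quotient (K : ModuleCat.{u} R) (rs : List R) :
    ∀ (M : Type u) [AddCommGroup M] [Module R M] (c : ℕ), IsWeaklyRegular M rs →
    (∀ i > c, Subsingleton (Ext (ModuleCat.of R M) K i)) →
    ∀ i > c + rs.length,
      Subsingleton (Ext (ModuleCat.of R (M ⧸ (Ideal.ofList rs • ⊤ : Submodule R M))) K i) := by
  induction rs with
  | nil =>
    intro M _ _ c _ h i hi
    exact subsingleton_ext_congr (Submodule.quotEquivOfEqBot _ (by simp)).symm K i (h i hi)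
  | cons r rs ih =>
    intro M _ _ c hM h i hi
    rw [isWeaklyRegular_cons_iff] at hM
    have hS := IsSMulRegular.smulShortComplex_shortExact (M := ModuleCat.of R M) hM.1
    refine subsingleton_ext_congr
      (Submodule.quotOfListConsSMulTopEquivQuotSMulTopInner M r rs).symm K i
      (ih _ (c + 1) hM.2 (fun j hj => subsingleton_of_forall_eq 0 fun x => ?_) i
        (by simp at hi; omega))
    -- Ext^j(M/rM, K) sits between Ext^(j-1)(M, K) and Ext^j(M, K), so each element of the sequence
    -- raises the bound c by one.
    obtain ⟨y, rfl⟩ := Ext.contravariant_sequence_exact₃ hS K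
      (show Ext ((ModuleCat.of R M).smulShortComplex r).X₃ K j from x)
      ((h j (by omega)).elim _ _) (show 1 + (j - 1) = j by omega)
    rw [show y = 0 from (h (j - 1) (by omega)).elim _ _, Ext.comp_zero]
    rfl

/-- The converse of `subsingleton_ext_quotient`, by Nakayama's lemma. -/
lemma subsingleton_ext_of_quotient [IsLocalRing R] [IsNoetherianRing R] (K : ModuleCat.{u} R)
    [Module.Finite R K] (rs : List R) (hrs : ∀ r ∈ rs, r ∈ maximalIdeal R) :
    ∀ (M : Type u) [AddCommGroup M] [Module R M] [Module.Finite R M] (c : ℕ),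
    IsWeaklyRegular M rs →
    (∀ i > c + rs.length,
      Subsingleton (Ext (ModuleCat.of R (M ⧸ (Ideal.ofList rs • ⊤ : Submodule R M))) K i)) →
    ∀ i > c, Subsingleton (Ext (ModuleCat.of R M) K i) := by
  induction rs with
  | nil =>
    intro M _ _ _ c _ h i hi
    exact subsingleton_ext_congr (Submodule.quotEquivOfEqBot _ (by simp)) K i (h i hi)
  | cons r rs ih =>
    intro M _ _ _ c hM h i hi
    rw [isWeaklyRegular_cons_iff] at hM
    have hS := IsSMulRegular.smulShortComplex_shortExact (M := ModuleCat.of R M) hM.1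
    have h' := ih (fun s hs => hrs s (List.mem_cons_of_mem _ hs)) (QuotSMulTop r M) (c + 1) hM.2
      fun j hj => subsingleton_ext_congr
        (Submodule.quotOfListConsSMulTopEquivQuotSMulTopInner M r rs) K j
        (h j (by simp; omega))
    -- The cokernel of r on Ext^i(M, K) embeds into Ext^(i+1)(M/rM, K), which vanishes.
    have hsurj : ∀ x : Ext (ModuleCat.of R M) K i, ∃ y, r • y = x := by
      intro x
      obtain ⟨y, hy⟩ := Ext.contravariant_sequence_exact₁ hS K
        (show Ext ((ModuleCat.of R M).smulShortComplex r).X₁ K i from x) (add_comm 1 i)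
        ((h' (i + 1) (by omega)).elim _ _)
      exact ⟨y, (smul_ext_eq_mk₀_comp r _).trans hy⟩
    have hbot : (⊤ : Submodule R (Ext (ModuleCat.of R M) K i)) = ⊥ := by
      refine Submodule.eq_bot_of_le_smul_of_le_jacobson_bot (maximalIdeal R) _ Module.Finite.fg_top
        (fun x _ => ?_) (maximalIdeal_le_jacobson _)
      obtain ⟨y, rfl⟩ := hsurj x
      exact Submodule.smul_mem_smul (hrs r List.mem_cons_self) trivial
    exact (Submodule.subsingleton_iff R).mp (subsingleton_of_bot_eq_top hbot.symm)

/-- Dévissage along a composition series: the residue field is the only simple module of a local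
ring. -/
lemma subsingleton_ext_of_isFiniteLength [IsLocalRing R] (K : ModuleCat.{u} R) (i : ℕ)
    (hk : Subsingleton (Ext (ModuleCat.of R (R ⧸ maximalIdeal R)) K i))
    {N : Type u} [AddCommGroup N] [Module R N] (hN : IsFiniteLength R N) :
    Subsingleton (Ext (ModuleCat.of R N) K i) := by
  induction hN with
  | of_subsingleton =>
    rename_i N _ _ _
    have : Subsingleton (Ext (ModuleCat.of R N) K i) := by
      refine subsingleton_of_forall_eq 0 fun x => ?_
      rw [← Ext.mk₀_id_comp x, show 𝟙 (ModuleCat.of R N) = 0 from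
        ModuleCat.hom_ext (LinearMap.ext fun y => Subsingleton.elim (α := N) _ _),
        Ext.mk₀_zero, Ext.zero_comp]
    exact this
  | of_simple_quotient _ ih =>
    rename_i N _ _ S hS _
    obtain ⟨I, hI, ⟨e⟩⟩ := isSimpleModule_iff_quot_maximal.mp hS
    rw [IsLocalRing.eq_maximalIdeal hI] at e
    exact subsingleton_ext_of_submodule S K i ih (subsingleton_ext_congr e.symm K i hk)

/-- Over a local ring, `Ext^i(N, K) = 0` for `N` of finite length, `K` of finite injective dimension
and `i` greater than the length of a regular sequence generating an ideal of finite colength. -/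
lemma subsingleton_ext_of_length_lt [IsLocalRing R] (K : ModuleCat.{u} R) (n : ℕ)
    (hK : HasInjectiveDimensionLE K n) (rs : List R) (hrs : ∀ r ∈ rs, r ∈ maximalIdeal R)
    (hreg : IsWeaklyRegular R rs) (hfin : IsFiniteLength R (R ⧸ Ideal.ofList rs))
    (i : ℕ) (hi : rs.length < i) {N : Type u} [AddCommGroup N] [Module R N]
    (hN : IsFiniteLength R N) : Subsingleton (Ext (ModuleCat.of R N) K i) := by
  -- Descending induction on i, with c bounding the distance up to n + 1, where the finite injective
  -- dimension forces vanishing.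
  obtain ⟨c, hc⟩ : ∃ c, n + 1 ≤ i + c := ⟨n + 1, by omega⟩
  induction c generalizing i N with
  | zero => exact HasInjectiveDimensionLT.subsingleton K (n + 1) i hc _
  | succ c ih =>
    refine subsingleton_ext_of_isFiniteLength K i ?_ hN
    have hne : Ideal.ofList rs ≠ ⊤ := fun h => (maximalIdeal.isMaximal R).ne_top
      (top_le_iff.mp (h ▸ Ideal.span_le.mpr hrs))
    have : Nontrivial (R ⧸ Ideal.ofList rs) := Ideal.Quotient.nontrivial_iff.mpr hne
    obtain ⟨_, hart⟩ := isFiniteLength_iff_isNoetherian_isArtinian.mp hfin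
    -- The residue field embeds into R/(rs) as a simple submodule S. Then Ext^i(S, K) lies between
    -- Ext^i(R/(rs), K), zero because i exceeds the length of rs, and Ext^(i+1) of the finite length
    -- quotient, zero by induction.
    obtain ⟨S, hS⟩ := IsAtomic.exists_atom (Submodule R (R ⧸ Ideal.ofList rs))
    rw [← isSimpleModule_iff_isAtom] at hS
    obtain ⟨I, hI, ⟨e⟩⟩ := isSimpleModule_iff_quot_maximal.mp hS
    rw [IsLocalRing.eq_maximalIdeal hI] at e
    refine subsingleton_ext_congr e K i (subsingleton_of_forall_eq 0 fun x => ?_)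
    have hQ : IsFiniteLength R ((R ⧸ Ideal.ofList rs) ⧸ S) :=
      isFiniteLength_iff_isNoetherian_isArtinian.mpr ⟨inferInstance, inferInstance⟩
    have h1 := ih (i + 1) (by omega) hQ (by omega)
    have h2 : Subsingleton (Ext (ModuleCat.of R (R ⧸ Ideal.ofList rs)) K i) := by
      refine subsingleton_ext_congr (Submodule.quotEquivOfEq _ _ (by simp)) K i
        (subsingleton_ext_quotient K rs R 0 hreg (fun j hj => ?_) i (by omega))
      obtain ⟨j, rfl⟩ := Nat.exists_eq_add_of_lt hj
      exact subsingleton_of_forall_eq 0 fun x => Ext.eq_zero_of_projective x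
    obtain ⟨y, hy⟩ := Ext.contravariant_sequence_exact₁ (subShortComplex_shortExact S) K
      (show Ext (subShortComplex S).X₁ K i from x) (add_comm 1 i) (h1.elim _ _)
    rw [← hy]
    rw [show y = 0 from h2.elim _ _, Ext.comp_zero]

/-- The obstruction to lifting along K → K/rK lies in Ext^1(M, K). All positive degrees are assumed
because Ext^i(M, K/rK) is controlled by Ext^i(M, K) and Ext^(i+1)(M, K), so the hypothesis passes to
K/rK. -/
lemma exists_comp_mkQ_eq (rs : List R) (M : ModuleCat.{u} R) :
    ∀ (K : Type u) [AddCommGroup K] [Module R K], IsWeaklyRegular K rs →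
    (∀ i > 0, Subsingleton (Ext M (ModuleCat.of R K) i)) →
    ∀ f : M →ₗ[R] K ⧸ (Ideal.ofList rs • ⊤ : Submodule R K), ∃ g : M →ₗ[R] K,
      (Submodule.mkQ _) ∘ₗ g = f := by
  induction rs with
  | nil =>
    intro K _ _ _ _ f
    let e : (K ⧸ (Ideal.ofList ([] : List R) • ⊤ : Submodule R K)) ≃ₗ[R] K :=
      Submodule.quotEquivOfEqBot _ (by simp)
    refine ⟨e.toLinearMap ∘ₗ f, LinearMap.ext fun x => e.injective ?_⟩
    simp [e]
  | cons r rs ih =>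
    intro K _ _ hK hv f
    rw [isWeaklyRegular_cons_iff] at hK
    have hS := IsSMulRegular.smulShortComplex_shortExact (M := ModuleCat.of R K) hK.1
    let e := Submodule.quotOfListConsSMulTopEquivQuotSMulTopInner K r rs
    have hv' : ∀ i > 0, Subsingleton (Ext M (ModuleCat.of R (QuotSMulTop r K)) i) := by
      refine fun i hi => subsingleton_of_forall_eq 0 fun x => ?_
      obtain ⟨y, rfl⟩ := Ext.covariant_sequence_exact₃ M hS
        (show Ext M ((ModuleCat.of R K).smulShortComplex r).X₃ i from x) rfl
        ((hv (i + 1) (by omega)).elim _ _)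
      rw [show y = 0 from (hv i hi).elim _ _, Ext.zero_comp]
      rfl
    obtain ⟨g, hg⟩ := ih (QuotSMulTop r K) hK.2 hv' (e.toLinearMap ∘ₗ f)
    obtain ⟨x, hx⟩ := Ext.covariant_sequence_exact₃ M hS
      (Ext.mk₀ (Y := ((ModuleCat.of R K).smulShortComplex r).X₃) (ModuleCat.ofHom g)) rfl
      ((hv 1 (by omega)).elim _ _)
    obtain ⟨h, rfl⟩ := (Ext.mk₀_bijective _ _).surjective x
    rw [Ext.mk₀_comp_mk₀] at hx
    replace hx := (Ext.mk₀_bijective _ _).injective hx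
    refine ⟨h.hom, LinearMap.ext fun y => e.injective ?_⟩
    have h1 : (Submodule.mkQ _ : K →ₗ[R] QuotSMulTop r K) (h.hom y) = g y :=
      congrArg (fun φ => φ.hom y) hx
    have h2 := LinearMap.congr_fun hg y
    exact Eq.trans (congrArg (Submodule.mkQ (Ideal.ofList rs • ⊤)) h1) h2

/-- If `Ext^{n+1}(-, K)` vanishes on modules of finite length and `rs` is a weakly `K`-regular
sequence of length `n`, then `K / rs K` is injective relative to finite length modules killed by
`rs`. -/
lemma exists_comp_eq_of_ker_le {K : Type u} [AddCommGroup K] [Module R K] {rs : List R}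
    (hK : IsWeaklyRegular K rs)
    (hv : ∀ (Q : Type u) [AddCommGroup Q] [Module R Q], IsFiniteLength R Q →
      Subsingleton (Ext (ModuleCat.of R Q) (ModuleCat.of R K) (rs.length + 1)))
    {N P : Type u} [AddCommGroup N] [Module R N] [AddCommGroup P] [Module R P]
    (hPann : Ideal.ofList rs ≤ Module.annihilator R P) (hP : IsFiniteLength R P)
    (ψ : N →ₗ[R] P) (g : N →ₗ[R] K ⧸ (Ideal.ofList rs • ⊤ : Submodule R K))
    (hg : LinearMap.ker ψ ≤ LinearMap.ker g) :
    ∃ h : P →ₗ[R] K ⧸ (Ideal.ofList rs • ⊤ : Submodule R K), h ∘ₗ ψ = g := by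
  obtain ⟨η, hη⟩ := exists_ext_bijective rs K hK
  let S := LinearMap.range ψ
  let g' : S →ₗ[R] K ⧸ (Ideal.ofList rs • ⊤ : Submodule R K) :=
    (LinearMap.ker ψ).liftQ g hg ∘ₗ ψ.quotKerEquivRange.symm.toLinearMap
  have hg' : ∀ x, g' ⟨ψ x, x, rfl⟩ = g x := fun x => by
    have : ψ.quotKerEquivRange.symm ⟨ψ x, x, rfl⟩ = Submodule.Quotient.mk x := by
      rw [LinearEquiv.symm_apply_eq]; rfl
    change (LinearMap.ker ψ).liftQ g hg (ψ.quotKerEquivRange.symm ⟨ψ x, x, rfl⟩) = g x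
    rw [this]; rfl
  have hPS : IsFiniteLength R (P ⧸ S) := by
    obtain ⟨_, _⟩ := isFiniteLength_iff_isNoetherian_isArtinian.mp hP
    exact isFiniteLength_iff_isNoetherian_isArtinian.mpr ⟨inferInstance, inferInstance⟩
  have hSann : Ideal.ofList rs ≤ Module.annihilator R S :=
    hPann.trans (LinearMap.annihilator_le_of_injective S.subtype S.subtype_injective)
  -- The class in Ext^n(S, K) representing g' extends to P, as the obstruction lies in
  -- Ext^(n+1)(P/S, K) = 0; representability on modules killed by rs turns the extension back into a
  -- homomorphism.
  obtain ⟨β, hβ⟩ := Ext.contravariant_sequence_exact₁ (subShortComplex_shortExact S)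
    (ModuleCat.of R K) ((Ext.mk₀ (X := (subShortComplex S).X₁) (ModuleCat.ofHom g')).comp η
      (zero_add _)) (add_comm 1 rs.length) ((hv _ hPS).elim _ _)
  obtain ⟨h, rfl⟩ := (hη (ModuleCat.of R P) (annihilator_of_le_annihilator hPann)).2.2 β
  replace hβ : (Ext.mk₀ (subShortComplex S).f).comp ((Ext.mk₀ h).comp η (zero_add _))
    (zero_add _) = _ := hβ
  rw [Ext.mk₀_comp_mk₀_assoc] at hβ
  have h2 := (hη (ModuleCat.of R S) (annihilator_of_le_annihilator hSann)).2.1 hβ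
  refine ⟨h.hom, LinearMap.ext fun x => ?_⟩
  rw [← hg' x]
  exact congrArg (fun φ => φ.hom (⟨ψ x, x, rfl⟩ : S)) h2

/-! ### Products, retracts and finite length -/

lemma subsingleton_ext_prod {A B : Type u} [AddCommGroup A] [Module R A] [AddCommGroup B]
    [Module R B] (N : ModuleCat.{u} R) (i : ℕ)
    (hA : Subsingleton (Ext N (ModuleCat.of R A) i))
    (hB : Subsingleton (Ext N (ModuleCat.of R B) i)) :
    Subsingleton (Ext N (ModuleCat.of R (A × B)) i) := by
  refine subsingleton_of_forall_eq 0 fun x => ?_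
  have hid : 𝟙 (ModuleCat.of R (A × B)) =
      ModuleCat.ofHom (LinearMap.fst R A B) ≫ ModuleCat.ofHom (LinearMap.inl R A B) +
      ModuleCat.ofHom (LinearMap.snd R A B) ≫ ModuleCat.ofHom (LinearMap.inr R A B) := by
    ext y <;> simp
  rw [← Ext.comp_mk₀_id x, hid, Ext.mk₀_add, Ext.comp_add, ← Ext.mk₀_comp_mk₀,
    ← Ext.mk₀_comp_mk₀, ← Ext.comp_assoc_of_third_deg_zero, ← Ext.comp_assoc_of_third_deg_zero,
    hA.elim (x.comp _ _) 0, hB.elim (x.comp _ _) 0]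
  simp

/-- Modulo any initial part of the sequence f stays a split injection, so regularity descends to
direct summands. -/
lemma isWeaklyRegular_of_retract {A P : Type*} [AddCommGroup A] [Module R A] [AddCommGroup P]
    [Module R P] (f : A →ₗ[R] P) (g : P →ₗ[R] A) (hgf : g ∘ₗ f = LinearMap.id) {rs : List R}
    (h : IsWeaklyRegular P rs) : IsWeaklyRegular A rs := by
  refine ⟨fun i hi => ?_⟩
  let I := Ideal.ofList (rs.take i)
  refine IsSMulRegular.of_injective (Submodule.mapQ (I • ⊤) (I • ⊤) f ?_) ?_
    (h.regular_mod_prev i hi)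
  · exact Submodule.smul_top_le_comap_smul_top I f
  · refine Function.LeftInverse.injective
      (g := Submodule.mapQ (I • ⊤) (I • ⊤) g (Submodule.smul_top_le_comap_smul_top I g)) ?_
    intro x
    obtain ⟨x, rfl⟩ := Submodule.Quotient.mk_surjective _ x
    simpa using congrArg (Submodule.Quotient.mk) (LinearMap.congr_fun hgf x)

/-- A finitely generated module killed by an ideal of finite colength has finite length. -/
lemma isFiniteLength_of_le_annihilator {I : Ideal R} (hI : IsFiniteLength R (R ⧸ I))
    {N : Type*} [AddCommGroup N] [Module R N] [Module.Finite R N]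
    (hN : I ≤ Module.annihilator R N) : IsFiniteLength R N := by
  obtain ⟨_, _⟩ := isFiniteLength_iff_isNoetherian_isArtinian.mp hI
  obtain ⟨t, m, hm⟩ := Module.Finite.exists_fin (R := R) (M := N)
  let φ : (Fin t → R ⧸ I) →ₗ[R] N := LinearMap.lsum R (fun _ => R ⧸ I) R fun j =>
    Submodule.liftQ I (LinearMap.toSpanSingleton R N (m j)) fun r hr => by
      simpa using Module.mem_annihilator.mp (hN hr) (m j)
  have hφ : Function.Surjective φ := by
    rw [← LinearMap.range_eq_top, eq_top_iff, ← hm, Submodule.span_le]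
    rintro _ ⟨j, rfl⟩
    refine ⟨Pi.single j 1, ?_⟩
    rw [LinearMap.lsum_piSingle]
    exact one_smul R (m j)
  exact isFiniteLength_iff_isNoetherian_isArtinian.mpr
    ⟨isNoetherian_of_surjective φ (LinearMap.range_eq_top.mpr hφ),
      isArtinian_of_surjective _ φ hφ⟩

lemma le_annihilator_quotient_smul_top (I : Ideal R) (N : Type*) [AddCommGroup N] [Module R N] :
    I ≤ Module.annihilator R (N ⧸ (I • ⊤ : Submodule R N)) := fun r hr => by
  refine Module.mem_annihilator.mpr fun x => ?_
  obtain ⟨x, rfl⟩ := Submodule.Quotient.mk_surjective _ x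
  exact (Submodule.Quotient.mk_eq_zero _).mpr (Submodule.smul_mem_smul hr Submodule.mem_top)

/-! ### Depth, dimension and maximal Cohen–Macaulay modules -/

variable [IsLocalRing R]

lemma depth_eq_top_of_subsingleton (M : Type*) [AddCommGroup M] [Module R M] [Subsingleton M] :
    depth R M = ⊤ := by
  refine ENat.eq_top_iff_forall_ge.mpr fun n => ?_
  refine le_iSup₂_of_le (List.replicate n (0 : R)) ⟨fun r hr => ?_, ⟨fun i hi => ?_⟩⟩ (by simp)
  · rw [List.eq_of_mem_replicate hr]; exact zero_mem _
  · exact fun x y _ => Subsingleton.elim _ _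

lemma ringKrullDim_eq_dim [IsNoetherianRing R] : ringKrullDim R = dim R := by
  obtain ⟨d, hd⟩ : ∃ d : ℕ, ringKrullDim R = d := by
    have h1 : ringKrullDim R ≠ ⊤ := ringKrullDim_lt_top.ne
    have h2 : ringKrullDim R ≠ ⊥ := ringKrullDim_ne_bot
    obtain ⟨e, he⟩ := WithBot.ne_bot_iff_exists.mp h2
    rw [← he] at h1 ⊢
    have h3 : e ≠ ⊤ := fun h => h1 (by rw [h]; rfl)
    lift e to ℕ using h3
    exact ⟨e, rfl⟩
  rw [dim, hd]
  rfl

lemma IsMCM.nontrivial [IsNoetherianRing R] {M : Type*} [AddCommGroup M] [Module R M]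
    (hM : IsMCM R M) : Nontrivial M := by
  by_contra h
  rw [not_nontrivial_iff_subsingleton] at h
  have := hM.depth_eq
  rw [depth_eq_top_of_subsingleton] at this
  exact ringKrullDim_lt_top.ne this.symm

lemma IsMCM.exists_isWeaklyRegular [IsNoetherianRing R] {M : Type*} [AddCommGroup M] [Module R M]
    (hM : IsMCM R M) : ∃ rs : List R, rs.length = dim R ∧ (∀ r ∈ rs, r ∈ maximalIdeal R) ∧
      IsWeaklyRegular M rs := by
  have hd : depth R M = dim R := by
    have := hM.depth_eq
    rw [ringKrullDim_eq_dim] at this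
    exact WithBot.coe_injective this
  rcases Nat.eq_zero_or_pos (dim R) with h0 | hpos
  · exact ⟨[], h0.symm, by simp, IsWeaklyRegular.nil R M⟩
  by_contra! hc
  -- Sequences longer than dim R could be truncated to exactly that length, so failure bounds every
  -- length by dim R - 1.
  have hle : depth R M ≤ (dim R - 1 : ℕ) := by
    refine iSup₂_le fun rs hrs => ?_
    by_contra! hlt
    have hlen : dim R ≤ rs.length := by
      have : dim R - 1 < rs.length := by exact_mod_cast hlt
      omega
    have hw := hrs.2
    rw [← List.take_append_drop (dim R) rs, isWeaklyRegular_append_iff] at hw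
    exact hc (rs.take (dim R)) (by simp [hlen]) (fun r hr => hrs.1 r (List.mem_of_mem_take hr)) hw.1
  rw [hd] at hle
  have : dim R ≤ dim R - 1 := by exact_mod_cast hle
  omega

lemma maximalIdeal_smul_top_lt (M : Type*) [AddCommGroup M] [Module R M]
    [Module.Finite R M] [Nontrivial M] : maximalIdeal R • (⊤ : Submodule R M) < ⊤ :=
  lt_top_iff_ne_top.mpr (Submodule.top_ne_ideal_smul_of_le_jacobson_annihilator
    (maximalIdeal_le_jacobson _)).symm

lemma IsMCM.subsingleton_ext [IsNoetherianRing R] {M : Type u} [AddCommGroup M] [Module R M]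
    (hM : IsMCM R M) (i : ℕ) (hi : i < dim R) :
    Subsingleton (Ext (ModuleCat.of R (R ⧸ maximalIdeal R)) (ModuleCat.of R M) i) := by
  obtain ⟨rs, hlen, hmem, hreg⟩ := hM.exists_isWeaklyRegular
  obtain ⟨η, hη⟩ := exists_ext_bijective rs M hreg
  refine (hη (ModuleCat.of R (R ⧸ maximalIdeal R)) fun r hr => ?_).1 i (hlen ▸ hi)
  simpa [Ideal.annihilator_quotient] using hmem r hr

/-- Finitely many maximal Cohen-Macaulay modules have a common regular sequence of length `dim R`;
here for three of them. -/
lemma exists_common_isWeaklyRegular [IsNoetherianRing R] {A B C : Type u} [AddCommGroup A]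
    [Module R A] [AddCommGroup B] [Module R B] [AddCommGroup C] [Module R C]
    (hA : IsMCM R A) (hB : IsMCM R B) (hC : IsMCM R C) :
    ∃ rs : List R, rs.length = dim R ∧ (∀ r ∈ rs, r ∈ maximalIdeal R) ∧
      IsWeaklyRegular A rs ∧ IsWeaklyRegular B rs ∧ IsWeaklyRegular (A × B) rs ∧
      IsWeaklyRegular C rs := by
  have := hA.nontrivial
  have := hA.finite
  have := hB.finite
  have := hC.finite
  -- Vanishing of Ext^i(R/𝔪, -) below dim R, unlike a chosen regular sequence, passes to the
  -- product; it then yields a sequence regular on all factors at once.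
  obtain ⟨rs, hlen, hmem, hreg⟩ := ModuleCat.exists_isRegular_of_exists_subsingleton_ext
    (maximalIdeal R) (dim R) (ModuleCat.of R (A × B × C)) (maximalIdeal_smul_top_lt _)
    (ModuleCat.of R (R ⧸ maximalIdeal R))
    (by
      rw [Module.support_eq_zeroLocus, Ideal.annihilator_quotient])
    fun i hi => subsingleton_ext_prod _ i (hA.subsingleton_ext i hi)
      (subsingleton_ext_prod _ i (hB.subsingleton_ext i hi) (hC.subsingleton_ext i hi))
  have h := hreg.toIsWeaklyRegular
  have hBC := isWeaklyRegular_of_retract (LinearMap.inr R A (B × C)) (LinearMap.snd R A (B × C))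
    (by ext <;> simp) h
  exact ⟨rs, hlen, hmem,
    isWeaklyRegular_of_retract (LinearMap.inl R A (B × C)) (LinearMap.fst R A (B × C))
      (by ext; simp) h,
    isWeaklyRegular_of_retract (LinearMap.inl R B C) (LinearMap.fst R B C) (by ext; simp) hBC,
    isWeaklyRegular_of_retract
      ((LinearMap.fst R A B).prod (LinearMap.inl R B C ∘ₗ LinearMap.snd R A B))
      ((LinearMap.fst R A (B × C)).prod (LinearMap.fst R B C ∘ₗ LinearMap.snd R A (B × C)))
      (by ext <;> simp) h,
    isWeaklyRegular_of_retract (LinearMap.inr R B C) (LinearMap.snd R B C) (by ext; simp) hBC⟩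

/-- A regular sequence of length `dim R` generates an ideal of finite colength. -/
lemma isFiniteLength_quotient_ofList [IsNoetherianRing R] {rs : List R}
    (hlen : rs.length = dim R) (hmem : ∀ r ∈ rs, r ∈ maximalIdeal R)
    (hreg : IsWeaklyRegular R rs) : IsFiniteLength R (R ⧸ Ideal.ofList rs) := by
  have hr : IsRegular R rs := IsRegular.of_isWeaklyRegular_of_mem_maximalIdeal R hmem hreg
  have h := ringKrullDim_add_length_eq_ringKrullDim_of_isRegular rs hr
  have : Nontrivial (R ⧸ Ideal.ofList rs) := Ideal.Quotient.nontrivial_iff.mpr fun h =>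
    (maximalIdeal.isMaximal R).ne_top (top_le_iff.mp (h ▸ Ideal.span_le.mpr hmem))
  have h0 : ringKrullDim (R ⧸ Ideal.ofList rs) = 0 := by
    rw [ringKrullDim_eq_dim (R := R), hlen] at h
    generalize ringKrullDim (R ⧸ Ideal.ofList rs) = x at h
    induction x with
    | bot => exact absurd h.symm (WithBot.coe_ne_bot (a := ((dim R : ℕ) : ℕ∞)))
    | coe x =>
      replace h : x + (dim R : ℕ∞) = 0 + (dim R : ℕ∞) := by
        rw [zero_add]
        exact WithBot.coe_injective h
      rw [WithTop.add_right_cancel (ENat.natCast_ne_top _) h]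
      rfl
  have hle : Ring.KrullDimLE 0 (R ⧸ Ideal.ofList rs) := Ring.krullDimLE_iff.mpr h0.le
  have hart : IsArtinianRing (R ⧸ Ideal.ofList rs) :=
    isArtinianRing_iff_isNoetherianRing_krullDimLE_zero.mpr ⟨inferInstance, hle⟩
  refine isFiniteLength_iff_isNoetherian_isArtinian.mpr ⟨inferInstance,
    isArtinian_of_surjective_algebraMap (R := R ⧸ Ideal.ofList rs)
      Ideal.Quotient.mk_surjective⟩

end Ext

/-! ### Duality into K / I K and the generators of the cokernel -/

section Algebra

open IsLocalRing

variable {R : Type*} [CommRing R]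

/-- The `R`-bilinear map `(x, a) ↦ a x` from `M` and `R / I` to `M / I M`. -/
noncomputable def quotSMul (I : Ideal R) (M : Type*) [AddCommGroup M] [Module R M] :
    M →ₗ[R] (R ⧸ I) →ₗ[R] M ⧸ (I • ⊤ : Submodule R M) :=
  (Submodule.liftQ I (LinearMap.toSpanSingleton R (M →ₗ[R] M ⧸ (I • ⊤ : Submodule R M))
    (Submodule.mkQ _)) (fun r hr => by
      ext x
      simpa using (Submodule.Quotient.mk_eq_zero _).mpr
        (Submodule.smul_mem_smul hr (Submodule.mem_top (x := x))))).flip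

lemma quotSMul_mk (I : Ideal R) {M : Type*} [AddCommGroup M] [Module R M] (x : M) (r : R) :
    quotSMul I M x (Ideal.Quotient.mk I r) = r • Submodule.mkQ (I • ⊤ : Submodule R M) x :=
  rfl

lemma quotSMul_one (I : Ideal R) {M : Type*} [AddCommGroup M] [Module R M] (x : M) :
    quotSMul I M x 1 = Submodule.mkQ (I • ⊤ : Submodule R M) x :=
  (quotSMul_mk I x 1).trans (one_smul _ _)

lemma quotSMul_map (I : Ideal R) {M N : Type*} [AddCommGroup M] [Module R M] [AddCommGroup N]
    [Module R N] (f : M →ₗ[R] N) (x : M) (a : R ⧸ I) :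
    quotSMul I N (f x) a = Submodule.mapQ (I • ⊤) (I • ⊤) f
      (Submodule.smul_top_le_comap_smul_top I f) (quotSMul I M x a) := by
  obtain ⟨r, rfl⟩ := Ideal.Quotient.mk_surjective a
  simp [quotSMul_mk]

variable [IsLocalRing R]

/-- The elements of the socle of `R / I` which annihilate `M / I M`. -/
def socleInfAnnihilator (I : Ideal R) (M : Type*) [AddCommGroup M] [Module R M] :
    Submodule R (R ⧸ I) where
  carrier := {a | (∀ r ∈ maximalIdeal R, r • a = 0) ∧ ∀ x : M, quotSMul I M x a = 0}
  zero_mem' := by simp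
  add_mem' ha hb := ⟨fun r hr => by rw [smul_add, ha.1 r hr, hb.1 r hr, add_zero],
    fun x => by rw [map_add, ha.2 x, hb.2 x, add_zero]⟩
  smul_mem' c a ha := ⟨fun r hr => by rw [smul_comm, ha.1 r hr, smul_zero],
    fun x => by rw [map_smul, ha.2 x, smul_zero]⟩

lemma mu_eq_length (C : Type*) [AddCommGroup C] [Module R C] [Module.Finite R C] :
    (mu R C : ℕ∞) = Module.length R (C ⧸ (maximalIdeal R • ⊤ : Submodule R C)) := by
  let : Field (R ⧸ maximalIdeal R) := Ideal.Quotient.field _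
  have e : ((⊤ : Submodule R C) ⧸ (maximalIdeal R • ⊤ : Submodule R (⊤ : Submodule R C))) ≃ₗ[R]
      C ⧸ (maximalIdeal R • ⊤ : Submodule R C) :=
    Submodule.Quotient.equiv _ _ Submodule.topEquiv (by
      rw [Submodule.map_smul'', Submodule.map_top, LinearEquiv.range])
  rw [mu, IsLocalRing.spanFinrank_eq_finrank_quotient _ Module.Finite.fg_top, ← e.length_eq,
    Module.length_eq_of_surjective (R := R ⧸ maximalIdeal R) (S := R)
      Ideal.Quotient.mk_surjective]
  exact (Module.length_eq_finrank (R ⧸ maximalIdeal R) _).symm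

/-- If `Hom(R/𝔪, E)` has length one, then `Hom(-, E)` preserves the length of finitely generated
modules killed by `𝔪`. -/
lemma length_linearMap_eq_of_killed {E : Type*} [AddCommGroup E] [Module R E]
    (hE : Module.length R ((R ⧸ maximalIdeal R) →ₗ[R] E) = 1)
    (V : Type*) [AddCommGroup V] [Module R V] [Module.Finite R V]
    (hV : ∀ r ∈ maximalIdeal R, ∀ v : V, r • v = 0) :
    Module.length R (V →ₗ[R] E) = Module.length R V := by
  let : Field (R ⧸ maximalIdeal R) := Ideal.Quotient.field _
  have ht : Module.IsTorsionBySet R V (maximalIdeal R) := fun v r => hV r r.2 v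
  let : Module (R ⧸ maximalIdeal R) V := ht.module
  have : IsScalarTower R (R ⧸ maximalIdeal R) V := ht.isScalarTower
  have : Module.Finite (R ⧸ maximalIdeal R) V := Module.Finite.of_restrictScalars_finite R _ _
  let e : V ≃ₗ[R] (Fin (Module.finrank (R ⧸ maximalIdeal R) V) → R ⧸ maximalIdeal R) :=
    (Module.finBasis (R ⧸ maximalIdeal R) V).equivFun.restrictScalars R
  have h1 : Module.length R (R ⧸ maximalIdeal R) = 1 := by
    rw [Module.length_eq_one_iff]
    exact isSimpleModule_iff_quot_maximal.mpr ⟨_, inferInstance, ⟨LinearEquiv.refl _ _⟩⟩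
  rw [e.length_eq, (LinearEquiv.congrLeft E R e).length_eq,
    ← (LinearMap.lsum R (fun _ => R ⧸ maximalIdeal R) R).length_eq, Module.length_pi_of_fintype,
    Module.length_pi_of_fintype]
  simp [h1, hE]

variable {I : Ideal R} {K M : Type*} [AddCommGroup K] [Module R K] [AddCommGroup M] [Module R M]

/-- An element a of V is killed by 𝔪, and f(m)a is the image of am = 0 under the map M/IM → K/IK
induced by f. -/
lemma quotSMul_eq_zero_of_mem {x : K} (hx : x ∈ (maximalIdeal R • ⊤ : Submodule R K) ⊔
    LinearMap.range (evalMap R M K)) {a : R ⧸ I} (ha : a ∈ socleInfAnnihilator I M) :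
    quotSMul I K x a = 0 := by
  let L : K →ₗ[R] K ⧸ (I • ⊤ : Submodule R K) := (quotSMul I K).flip a
  suffices h : (maximalIdeal R • ⊤ : Submodule R K) ⊔ LinearMap.range (evalMap R M K) ≤
      LinearMap.ker L from h hx
  refine sup_le (Submodule.smul_le.mpr fun r hr y _ => ?_) ?_
  · change quotSMul I K (r • y) a = 0
    rw [map_smul, LinearMap.smul_apply, ← map_smul, ha.1 r hr, map_zero]
  · rintro _ ⟨z, rfl⟩
    induction z with
    | zero => simp
    | add y z hy hz => rw [map_add]; exact add_mem hy hz
    | tmul f m =>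
      change quotSMul I K (evalMap R M K (f ⊗ₜ m)) a = 0
      rw [evalMap_tmul, quotSMul_map, ha.2, map_zero]

/-- With generators y_i of 𝔪 and m_j of M, the map ψ : a ↦ (y_i a, a m_j) has kernel inside V, so a
↦ ax factors as h ∘ ψ. Evaluating at 1 writes x modulo IK as a sum of terms y_i h(e_i), in the image
of 𝔪K, and h_j(m_j), with h_j : M → K/IK lifting to K and so contributing elements of im t. -/
lemma mem_of_quotSMul_eq_zero [IsNoetherianRing R] [Module.Finite R M] (hI : I ≤ maximalIdeal R)
    (hext : ∀ {s t : ℕ} (ψ : (R ⧸ I) →ₗ[R]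
        ((Fin s → R ⧸ I) × (Fin t → M ⧸ (I • ⊤ : Submodule R M))))
      (g : (R ⧸ I) →ₗ[R] K ⧸ (I • ⊤ : Submodule R K)),
      LinearMap.ker ψ ≤ LinearMap.ker g → ∃ h, h ∘ₗ ψ = g)
    (hlift : ∀ f : M →ₗ[R] K ⧸ (I • ⊤ : Submodule R K), ∃ g : M →ₗ[R] K,
      (Submodule.mkQ _) ∘ₗ g = f)
    {x : K} (hx : ∀ a ∈ socleInfAnnihilator I M, quotSMul I K x a = 0) :
    x ∈ (maximalIdeal R • ⊤ : Submodule R K) ⊔ LinearMap.range (evalMap R M K) := by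
  obtain ⟨s, y, hy⟩ := Submodule.fg_iff_exists_fin_generating_family.mp
    (IsNoetherian.noetherian (maximalIdeal R))
  obtain ⟨t, m, hm⟩ := Module.Finite.exists_fin (R := R) (M := M)
  have hym : ∀ i, y i ∈ maximalIdeal R := fun i => hy ▸ Submodule.subset_span ⟨i, rfl⟩
  let ψ : (R ⧸ I) →ₗ[R] ((Fin s → R ⧸ I) × (Fin t → M ⧸ (I • ⊤ : Submodule R M))) :=
    (LinearMap.pi fun i => LinearMap.lsmul R (R ⧸ I) (y i)).prod
      (LinearMap.pi fun j => quotSMul I M (m j))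
  have hker : LinearMap.ker ψ ≤ socleInfAnnihilator I M := by
    intro a ha
    rw [LinearMap.mem_ker, Prod.ext_iff] at ha
    constructor
    · suffices h : maximalIdeal R ≤ LinearMap.ker (LinearMap.toSpanSingleton R (R ⧸ I) a) from
        fun r hr => by simpa using h hr
      rw [← hy, Submodule.span_le]
      rintro _ ⟨i, rfl⟩
      simpa [ψ] using congrFun ha.1 i
    · suffices h : ⊤ ≤ LinearMap.ker ((quotSMul I M).flip a) from
        fun x => h (Submodule.mem_top (x := x))
      refine hm.symm.trans_le (Submodule.span_le.mpr ?_)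
      rintro _ ⟨j, rfl⟩
      exact congrFun ha.2 j
  obtain ⟨h, hh⟩ := hext ψ (quotSMul I K x) fun a ha => hx a (hker ha)
  let W := (maximalIdeal R • ⊤ : Submodule R K) ⊔ LinearMap.range (evalMap R M K)
  have hW : Submodule.mkQ (I • ⊤ : Submodule R K) x ∈ W.map (Submodule.mkQ _) := by
    have h1 : ψ 1 = ∑ i, y i • (LinearMap.inl R _ _ (Pi.single i 1)) +
        ∑ j, LinearMap.inr R _ _ (Pi.single j (Submodule.mkQ _ (m j))) := by
      refine Prod.ext ?_ ?_
      · ext i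
        simp [ψ, Prod.fst_sum, Finset.sum_apply, Pi.single_apply]
      · ext j
        simp [ψ, Prod.snd_sum, Finset.sum_apply, Pi.single_apply, quotSMul_one]
    rw [← quotSMul_one, ← hh, LinearMap.comp_apply, h1, map_add, map_sum, map_sum]
    refine add_mem (sum_mem fun i _ => ?_) (sum_mem fun j _ => ?_)
    · obtain ⟨e, he⟩ := Submodule.mkQ_surjective _ (h (LinearMap.inl R _ _ (Pi.single i 1)))
      rw [map_smul, ← he, ← map_smul]
      exact Submodule.mem_map_of_mem (Submodule.mem_sup_left
        (Submodule.smul_mem_smul (hym i) Submodule.mem_top))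
    · obtain ⟨g, hg⟩ := hlift (h ∘ₗ LinearMap.inr R _ _ ∘ₗ LinearMap.single R _ j ∘ₗ
        Submodule.mkQ _)
      have := LinearMap.congr_fun hg (m j)
      refine ⟨g (m j), Submodule.mem_sup_right ⟨g ⊗ₜ m j, evalMap_tmul R M K g (m j)⟩, this⟩
  obtain ⟨w, hw, hwx⟩ := hW
  have hsub : x - w ∈ (I • ⊤ : Submodule R K) := by
    rw [← Submodule.Quotient.mk_eq_zero, Submodule.Quotient.mk_sub, sub_eq_zero]
    exact hwx.symm
  have := add_mem (Submodule.mem_sup_left (Submodule.smul_mono_left hI hsub) : x - w ∈ W) hw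
  simpa using this

lemma mu_coker_evalMap [IsNoetherianRing R] [Module.Finite R M] [Module.Finite R K]
    (hI : I ≤ maximalIdeal R)
    (hext : ∀ {s t : ℕ} (ψ : (R ⧸ I) →ₗ[R]
        ((Fin s → R ⧸ I) × (Fin t → M ⧸ (I • ⊤ : Submodule R M))))
      (g : (R ⧸ I) →ₗ[R] K ⧸ (I • ⊤ : Submodule R K)),
      LinearMap.ker ψ ≤ LinearMap.ker g → ∃ h, h ∘ₗ ψ = g)
    (hext' : ∀ (V : Submodule R (R ⧸ I)) (g : V →ₗ[R] K ⧸ (I • ⊤ : Submodule R K)),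
      ∃ h, h ∘ₗ V.subtype = g)
    (hlift : ∀ f : M →ₗ[R] K ⧸ (I • ⊤ : Submodule R K), ∃ g : M →ₗ[R] K,
      (Submodule.mkQ _) ∘ₗ g = f)
    (hE : Module.length R ((R ⧸ maximalIdeal R) →ₗ[R] K ⧸ (I • ⊤ : Submodule R K)) = 1) :
    (mu R (K ⧸ LinearMap.range (evalMap R M K)) : ℕ∞) =
      Module.length R (socleInfAnnihilator I M) := by
  let T := LinearMap.range (evalMap R M K)
  let W := (maximalIdeal R • ⊤ : Submodule R K) ⊔ T
  let V := socleInfAnnihilator I M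
  let Φ : K →ₗ[R] V →ₗ[R] K ⧸ (I • ⊤ : Submodule R K) :=
    (LinearMap.lcomp R _ V.subtype) ∘ₗ quotSMul I K
  have hΦ : Function.Surjective Φ := by
    intro f
    -- Extended to R/I, the functional is multiplication by its value at 1, which lifts to K.
    obtain ⟨h, rfl⟩ := hext' V f
    obtain ⟨x, hx⟩ := Submodule.mkQ_surjective _ (h 1)
    refine ⟨x, LinearMap.ext fun a => ?_⟩
    change quotSMul I K x a.1 = h a.1
    obtain ⟨r, hr⟩ := Ideal.Quotient.mk_surjective a.1
    rw [← hr, quotSMul_mk, hx, ← map_smul]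
    congr 1
    simp [Algebra.smul_def]
  have hkΦ : LinearMap.ker Φ = W := by
    ext x
    constructor
    · intro hx
      exact mem_of_quotSMul_eq_zero hI hext hlift fun a ha => LinearMap.congr_fun hx ⟨a, ha⟩
    · intro hx
      exact LinearMap.ext fun a => quotSMul_eq_zero_of_mem hx a.2
  let π : K →ₗ[R] (K ⧸ T) ⧸ (maximalIdeal R • ⊤ : Submodule R (K ⧸ T)) :=
    Submodule.mkQ _ ∘ₗ Submodule.mkQ _
  have hπ : Function.Surjective π :=
    (Submodule.mkQ_surjective _).comp (Submodule.mkQ_surjective _)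
  have hkπ : LinearMap.ker π = W := by
    rw [LinearMap.ker_comp, Submodule.ker_mkQ,
      Submodule.comap_smul_top_of_surjective _ _ (Submodule.mkQ_surjective _), Submodule.ker_mkQ]
  rw [mu_eq_length, ← (π.quotKerEquivOfSurjective hπ).length_eq,
    (Submodule.quotEquivOfEq _ _ (hkπ.trans hkΦ.symm)).length_eq,
    (Φ.quotKerEquivOfSurjective hΦ).length_eq]
  exact length_linearMap_eq_of_killed hE V fun r hr v => Subtype.ext (v.2.1 r hr)

end Algebra

/-! ### The idealization: dimension, regular sequences and socle -/

section TrivSqZeroExt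

open IsLocalRing RingTheory.Sequence TrivSqZeroExt

/-- `Hom(R/I, N)` is the submodule of `N` of elements killed by `I`. -/
noncomputable def homQuotientEquivTorsionBySet {R : Type*} [CommRing R] (I : Ideal R) (N : Type*)
    [AddCommGroup N] [Module R N] :
    ((R ⧸ I) →ₗ[R] N) ≃ₗ[R] Submodule.torsionBySet R N I where
  toFun f := ⟨f 1, (Submodule.mem_torsionBySet_iff _ _).mpr fun r => by
    rw [← map_smul, Algebra.smul_def, mul_one, Ideal.Quotient.algebraMap_eq,
      Ideal.Quotient.eq_zero_iff_mem.mpr r.2, map_zero]⟩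
  map_add' _ _ := rfl
  map_smul' _ _ := rfl
  invFun x := Submodule.liftQ I (LinearMap.toSpanSingleton R N x.1) fun r hr => by
    simpa using (Submodule.mem_torsionBySet_iff _ _).mp x.2 ⟨r, hr⟩
  left_inv f := by
    refine Submodule.linearMap_qext _ (LinearMap.ext_ring ?_)
    exact one_smul R (f 1)
  right_inv x := Subtype.ext (one_smul R x.1)

/-- Scalars act through a surjection, so the submodule lattices agree; this compares lengths over R
⋉ M and over R. -/
lemma length_eq_of_bijective {S R X Y : Type*} [CommRing S] [CommRing R] [AddCommGroup X]
    [Module S X] [AddCommGroup Y] [Module R Y] {σ : S →+* R} [RingHomSurjective σ]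
    (f : X →ₛₗ[σ] Y) (hf : Function.Bijective f) : Module.length S X = Module.length R Y := by
  rw [Module.length, Module.length, WithBot.unbot_inj,
    Order.krullDim_eq_of_orderIso (Submodule.orderIsoMapComapOfBijective f hf)]

variable {R : Type*} [CommRing R] {M : Type*} [AddCommGroup M] [Module R M] [Module Rᵐᵒᵖ M]
  [IsCentralScalar R M]

variable (R M) in
-- The summand M squares to zero, hence lies in every prime, and a prime is determined by its
-- contraction to R.
lemma ringKrullDim_trivSqZeroExt : ringKrullDim (TrivSqZeroExt R M) = ringKrullDim R := by
  refine le_antisymm (Order.krullDim_le_of_strictMono (PrimeSpectrum.comap (inlHom R M))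
      (Monotone.strictMono_of_injective (fun p q h => Ideal.comap_mono h) fun p q h => ?_))
    (ringKrullDim_le_of_surjective (fstHom R R M).toRingHom fst_surjective)
  have hmem : ∀ (p : PrimeSpectrum (TrivSqZeroExt R M)) (s : TrivSqZeroExt R M),
      s ∈ p.asIdeal ↔ s.fst ∈ (PrimeSpectrum.comap (inlHom R M) p).asIdeal := by
    intro p s
    have hinr : inr s.snd ∈ p.asIdeal := by
      refine p.2.mem_of_pow_mem 2 ?_
      rw [pow_two, inr_mul_inr]
      exact zero_mem _
    nth_rw 1 [← inl_fst_add_inr_snd_eq s]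
    exact Ideal.add_mem_iff_left _ hinr
  ext s
  rw [hmem p, hmem q, h]

variable (R M) in
lemma dim_trivSqZeroExt : dim (TrivSqZeroExt R M) = dim R := by
  rw [dim, dim, ringKrullDim_trivSqZeroExt]

lemma isWeaklyRegular_map_inl {rs : List R} (h : IsWeaklyRegular (R × M) rs) :
    IsWeaklyRegular (TrivSqZeroExt R M) (rs.map (algebraMap R (TrivSqZeroExt R M))) := by
  rw [isWeaklyRegular_map_algebraMap_iff]
  let e : TrivSqZeroExt R M ≃ₗ[R] R × M :=
    { toFun s := (s.fst, s.snd)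
      invFun p := inl p.1 + inr p.2
      map_add' _ _ := rfl
      map_smul' _ _ := rfl
      left_inv s := inl_fst_add_inr_snd_eq s
      right_inv p := by simp }
  exact (e.isWeaklyRegular_congr rs).mpr h

lemma mem_map_inl_iff (I : Ideal R) (s : TrivSqZeroExt R M) :
    s ∈ I.map (algebraMap R (TrivSqZeroExt R M)) ↔
      s.fst ∈ I ∧ s.snd ∈ (I • ⊤ : Submodule R M) := by
  constructor
  · intro hs
    refine Submodule.span_induction (p := fun s _ => s.fst ∈ I ∧ s.snd ∈ (I • ⊤ : Submodule R M))
      ?_ ?_ ?_ ?_ hs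
    · rintro _ ⟨r, hr, rfl⟩
      exact ⟨hr, zero_mem _⟩
    · exact ⟨zero_mem _, zero_mem _⟩
    · exact fun x y _ _ hx hy => ⟨add_mem hx.1 hy.1, add_mem hx.2 hy.2⟩
    · intro a x _ hx
      refine ⟨I.mul_mem_left _ hx.1, ?_⟩
      rw [smul_eq_mul, snd_mul, op_smul_eq_smul]
      exact add_mem (Submodule.smul_mem _ _ hx.2)
        (Submodule.smul_mem_smul hx.1 Submodule.mem_top)
  · rintro ⟨h1, h2⟩
    rw [← inl_fst_add_inr_snd_eq s]
    refine add_mem (Ideal.mem_map_of_mem _ h1) ?_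
    generalize s.snd = x at h2
    induction h2 using Submodule.smul_induction_on' with
    | smul r hr m _ =>
      rw [← inl_mul_inr]
      exact Ideal.mul_mem_right _ _ (Ideal.mem_map_of_mem _ hr)
    | add x _ y _ hx hy => rw [inr_add]; exact add_mem hx hy

variable (M) in
/-- The identification of `(R ⋉ M) / I (R ⋉ M)` with `R / I × M / I M` as an additive group. -/
noncomputable def quotientMapInlHom (I : Ideal R) :
    (TrivSqZeroExt R M ⧸ I.map (algebraMap R (TrivSqZeroExt R M))) →+
      (R ⧸ I) × (M ⧸ (I • ⊤ : Submodule R M)) :=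
  QuotientAddGroup.lift (I.map (algebraMap R (TrivSqZeroExt R M))).toAddSubgroup
    { toFun s := (Ideal.Quotient.mk I s.fst, Submodule.Quotient.mk s.snd)
      map_zero' := rfl
      map_add' _ _ := rfl }
    fun s hs => by
      have := (mem_map_inl_iff I s).mp hs
      exact Prod.ext (Ideal.Quotient.eq_zero_iff_mem.mpr this.1)
        ((Submodule.Quotient.mk_eq_zero _).mpr this.2)

lemma quotientMapInlHom_mk (I : Ideal R) (s : TrivSqZeroExt R M) :
    quotientMapInlHom M I (Ideal.Quotient.mk _ s) =
      (Ideal.Quotient.mk I s.fst, Submodule.Quotient.mk s.snd) := rfl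

lemma quotientMapInlHom_injective (I : Ideal R) :
    Function.Injective (quotientMapInlHom M I) := by
  refine (injective_iff_map_eq_zero _).mpr fun z hz => ?_
  obtain ⟨s, rfl⟩ := Ideal.Quotient.mk_surjective z
  rw [quotientMapInlHom_mk, Prod.mk_eq_zero, Ideal.Quotient.eq_zero_iff_mem,
    Submodule.Quotient.mk_eq_zero] at hz
  exact Ideal.Quotient.eq_zero_iff_mem.mpr ((mem_map_inl_iff I s).mpr hz)

lemma quotientMapInlHom_surjective (I : Ideal R) :
    Function.Surjective (quotientMapInlHom M I) := by
  rintro ⟨a, b⟩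
  obtain ⟨a, rfl⟩ := Ideal.Quotient.mk_surjective a
  obtain ⟨b, rfl⟩ := Submodule.Quotient.mk_surjective _ b
  exact ⟨Ideal.Quotient.mk _ (inl a + inr b), by simp [quotientMapInlHom_mk]⟩

lemma quotientMapInlHom_smul (I : Ideal R) (s : TrivSqZeroExt R M)
    (z : TrivSqZeroExt R M ⧸ I.map (algebraMap R (TrivSqZeroExt R M))) :
    quotientMapInlHom M I (s • z) = (s.fst • (quotientMapInlHom M I z).1,
      s.fst • (quotientMapInlHom M I z).2 + quotSMul I M s.snd (quotientMapInlHom M I z).1) := by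
  obtain ⟨t, rfl⟩ := Ideal.Quotient.mk_surjective z
  have : s • Ideal.Quotient.mk (I.map (algebraMap R (TrivSqZeroExt R M))) t =
    Ideal.Quotient.mk _ (s * t) := rfl
  rw [this, quotientMapInlHom_mk, quotientMapInlHom_mk, fst_mul, snd_mul, op_smul_eq_smul,
    quotSMul_mk]
  rfl

variable [IsLocalRing R]

lemma mem_maximalIdeal_trivSqZeroExt (s : TrivSqZeroExt R M) :
    s ∈ maximalIdeal (TrivSqZeroExt R M) ↔ s.fst ∈ maximalIdeal R := by
  rw [mem_maximalIdeal, mem_maximalIdeal, mem_nonunits_iff, mem_nonunits_iff,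
    isUnit_iff_isUnit_fst]

lemma mem_torsionBySet_iff_quotientMapInlHom (I : Ideal R)
    (z : TrivSqZeroExt R M ⧸ I.map (algebraMap R (TrivSqZeroExt R M))) :
    z ∈ Submodule.torsionBySet (TrivSqZeroExt R M) _ (maximalIdeal (TrivSqZeroExt R M)) ↔
      (quotientMapInlHom M I z).1 ∈ socleInfAnnihilator I M ∧
      (quotientMapInlHom M I z).2 ∈ Submodule.torsionBySet R _ (maximalIdeal R) := by
  rw [Submodule.mem_torsionBySet_iff, Submodule.mem_torsionBySet_iff]
  constructor
  · intro h
    have h' : ∀ s : TrivSqZeroExt R M, s.fst ∈ maximalIdeal R →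
        s.fst • (quotientMapInlHom M I z).1 = 0 ∧ s.fst • (quotientMapInlHom M I z).2 +
          quotSMul I M s.snd (quotientMapInlHom M I z).1 = 0 := fun s hs => by
      have := congrArg (quotientMapInlHom M I) (h ⟨s, (mem_maximalIdeal_trivSqZeroExt s).mpr hs⟩)
      rw [quotientMapInlHom_smul, map_zero] at this
      exact Prod.mk_eq_zero.mp this
    -- Testing on (r, 0) with r ∈ 𝔪 gives the two socle conditions; testing on (0, x) gives the
    -- annihilation of M/IM.
    refine ⟨⟨fun r hr => (h' (inl r) hr).1, fun x => ?_⟩, fun r => ?_⟩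
    · simpa using (h' (inr x) (zero_mem _)).2
    · simpa using (h' (inl r.1) r.2).2
  · rintro ⟨h1, h2⟩ ⟨s, hs⟩
    apply quotientMapInlHom_injective I
    rw [quotientMapInlHom_smul, map_zero, h1.2, add_zero]
    have hs' := (mem_maximalIdeal_trivSqZeroExt s).mp hs
    exact Prod.ext (h1.1 _ hs') (h2 ⟨_, hs'⟩)

/-- The length of the socle of `(R ⋉ M) / I (R ⋉ M)`. -/
lemma length_torsionBySet_trivSqZeroExt (I : Ideal R) :
    Module.length (TrivSqZeroExt R M) (Submodule.torsionBySet (TrivSqZeroExt R M)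
        (TrivSqZeroExt R M ⧸ I.map (algebraMap R (TrivSqZeroExt R M)))
        (maximalIdeal (TrivSqZeroExt R M))) =
      Module.length R (socleInfAnnihilator I M) + Module.length R
        (Submodule.torsionBySet R (M ⧸ (I • ⊤ : Submodule R M)) (maximalIdeal R)) := by
  rw [← Module.length_prod]
  have : RingHomSurjective (fstHom R R M).toRingHom := ⟨fst_surjective⟩
  let f : Submodule.torsionBySet (TrivSqZeroExt R M)
        (TrivSqZeroExt R M ⧸ I.map (algebraMap R (TrivSqZeroExt R M)))
        (maximalIdeal (TrivSqZeroExt R M)) →ₛₗ[(fstHom R R M).toRingHom]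
      socleInfAnnihilator I M ×
        Submodule.torsionBySet R (M ⧸ (I • ⊤ : Submodule R M)) (maximalIdeal R) :=
    { toFun z := (⟨_, ((mem_torsionBySet_iff_quotientMapInlHom I z.1).mp z.2).1⟩,
        ⟨_, ((mem_torsionBySet_iff_quotientMapInlHom I z.1).mp z.2).2⟩)
      map_add' z w := by
        ext <;> simp
      map_smul' s z := by
        have h := ((mem_torsionBySet_iff_quotientMapInlHom I z.1).mp z.2).1.2 s.snd
        have h2 := quotientMapInlHom_smul I s z.1
        rw [h, add_zero] at h2
        exact Prod.ext (Subtype.ext (congrArg Prod.fst h2)) (Subtype.ext (congrArg Prod.snd h2)) }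
  refine length_eq_of_bijective f ⟨fun z w h => ?_, ?_⟩
  · refine Subtype.ext (quotientMapInlHom_injective I (Prod.ext ?_ ?_))
    · exact congrArg (fun p => p.1.1) h
    · exact congrArg (fun p => p.2.1) h
  · rintro ⟨⟨a, ha⟩, ⟨b, hb⟩⟩
    obtain ⟨z, hz⟩ := quotientMapInlHom_surjective I (a, b)
    refine ⟨⟨z, (mem_torsionBySet_iff_quotientMapInlHom I z).mpr (by rw [hz]; exact ⟨ha, hb⟩)⟩,
      Prod.ext (Subtype.ext ?_) (Subtype.ext ?_)⟩
    · exact congrArg Prod.fst hz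
    · exact congrArg Prod.snd hz

end TrivSqZeroExt

end Idealization

/-! ### The type formula -/

open Idealization in
theorem theorem3p3 (R : Type u) [CommRing R] [IsLocalRing R] (hR : IsCohenMacaulay R)
    (M : Type u) [AddCommGroup M] [Module R M] [Module Rᵐᵒᵖ M] [IsCentralScalar R M]
    (hM : IsMCM R M)
    (K : Type u) [AddCommGroup K] [Module R K] (hK : IsCanonicalModule R K) :
    cmType (TrivSqZeroExt R M) (TrivSqZeroExt R M) =
      cmType R M + (mu R (K ⧸ LinearMap.range (evalMap R M K)) : ℕ∞) := by
  have := hR.noetherian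
  have := hM.finite
  have := hK.isMCM.finite
  obtain ⟨rs, hlen, hmem, hregR, hregM, hregRM, hregK⟩ :=
    exists_common_isWeaklyRegular (A := R) ⟨inferInstance, hR.depth_eq⟩ hM hK.isMCM
  obtain ⟨n, hn⟩ := hK.finite_injectiveDimension
  have hI : Ideal.ofList rs ≤ IsLocalRing.maximalIdeal R := Ideal.span_le.mpr hmem
  have hk : Ideal.ofList rs ≤ Module.annihilator R (R ⧸ IsLocalRing.maximalIdeal R) := by
    rwa [Ideal.annihilator_quotient]
  have hfinR := isFiniteLength_quotient_ofList hlen hmem hregR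
  have hfin : ∀ (N : Type u) [AddCommGroup N] [Module R N] [Module.Finite R N],
      IsFiniteLength R (N ⧸ (Ideal.ofList rs • ⊤ : Submodule R N)) :=
    fun N => isFiniteLength_of_le_annihilator hfinR (le_annihilator_quotient_smul_top _ N)
  have hv : ∀ i, rs.length < i → ∀ (Q : Type u) [AddCommGroup Q] [Module R Q],
      IsFiniteLength R Q → Subsingleton (Abelian.Ext (ModuleCat.of R Q) (ModuleCat.of R K) i) :=
    fun i hi Q _ _ hQ => subsingleton_ext_of_length_lt _ n hn rs hmem hregR hfinR i hi hQ
  -- M/IM has finite length, so its Ext into K vanishes above degree d; undoing the d quotients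
  -- lowers this bound to 0.
  have hvM : ∀ i > 0, Subsingleton (Abelian.Ext (ModuleCat.of R M) (ModuleCat.of R K) i) :=
    subsingleton_ext_of_quotient _ rs hmem M 0 hregM fun i hi => hv i (by omega) _ (hfin M)
  have hext := fun {N P : Type u} [AddCommGroup N] [Module R N] [AddCommGroup P] [Module R P] =>
    exists_comp_eq_of_ker_le (N := N) (P := P) hregK (hv _ (Nat.lt_succ_self _))
  have hannR : Ideal.ofList rs ≤ Module.annihilator R (R ⧸ Ideal.ofList rs) := by
    rw [Ideal.annihilator_quotient]
  -- Type one of K says that the socle of K/IK has length one.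
  have hE : Module.length R ((R ⧸ IsLocalRing.maximalIdeal R) →ₗ[R]
      K ⧸ (Ideal.ofList rs • ⊤ : Submodule R K)) = 1 := by
    rw [← length_ext_eq hregK _ hk, hlen]
    exact hK.cmType_eq_one
  have hannP : ∀ s t : ℕ, Ideal.ofList rs ≤ Module.annihilator R
      ((Fin s → R ⧸ Ideal.ofList rs) × (Fin t → M ⧸ (Ideal.ofList rs • ⊤ : Submodule R M))) :=
    fun s t r hr => Module.mem_annihilator.mpr fun p => Prod.ext
      (funext fun i => Module.mem_annihilator.mp (hannR hr) (p.1 i))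
      (funext fun j => Module.mem_annihilator.mp (le_annihilator_quotient_smul_top _ M hr) (p.2 j))
  have hmu := mu_coker_evalMap (M := M) hI
    (fun {s t} ψ g hg => hext (hannP s t) (isFiniteLength_of_le_annihilator hfinR (hannP s t))
      ψ g hg)
    (fun V g => hext hannR hfinR V.subtype g (by simp))
    (exists_comp_mkQ_eq rs (ModuleCat.of R M) K hregK hvM) hE
  rw [hmu, add_comm]
  have hJ : Ideal.ofList (rs.map (algebraMap R (TrivSqZeroExt R M))) ≤ Module.annihilator
      (TrivSqZeroExt R M) (TrivSqZeroExt R M ⧸ IsLocalRing.maximalIdeal (TrivSqZeroExt R M)) := by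
    rw [Ideal.annihilator_quotient]
    refine Ideal.span_le.mpr fun s hs => ?_
    obtain ⟨r, hr, rfl⟩ := List.mem_map.mp hs
    exact (mem_maximalIdeal_trivSqZeroExt _).mpr (hmem r hr)
  have hS := length_ext_eq (isWeaklyRegular_map_inl hregRM) _ hJ
  have hlen' : (rs.map (algebraMap R (TrivSqZeroExt R M))).length = dim (TrivSqZeroExt R M) := by
    rw [List.length_map, hlen, dim_trivSqZeroExt]
  rw [hlen'] at hS
  have hQ : (Ideal.ofList (rs.map (algebraMap R (TrivSqZeroExt R M))) • ⊤ :
      Ideal (TrivSqZeroExt R M)) = (Ideal.ofList rs).map (algebraMap R (TrivSqZeroExt R M)) := by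
    rw [Ideal.map_ofList, smul_eq_mul, Ideal.mul_top]
  rw [cmType, hS, (homQuotientEquivTorsionBySet _ _).length_eq, hQ,
    length_torsionBySet_trivSqZeroExt, cmType, ← hlen, length_ext_eq hregM _ hk,
    (homQuotientEquivTorsionBySet _ _).length_eq]
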